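/- Let $G=(V,E)$ be a finite connected graph without loops or multiple edges in which every vertex has degree at least $2$. An oriented edge $e$ has an initial vertex $\iota(e)$, a terminal vertex $\tau(e)$ and a reverse $\bar e$; write $e\frown f$ if $\tau(e)=\iota(f)$ and $e\neq\bar f$. Let $\mathcal P$ be the set of infinite paths without backtracking, i.e. sequences $p=(e_0,e_1,e_2,\dots)$ of oriented edges with $e_i\frown e_{i+1}$ for all $i\ge 0$. Fix $\vartheta\in(0,1)$ and let $d_\vartheta(p,q)=\vartheta^{\inf\{i\,:\,p_i\neq q_i\}}$ for $p\ne q$ and $d_\vartheta(p,p)=0$. Let $L_\vartheta$ be the space of all bounded functions $\varphi:\mathcal P\to\mathbb C$ for which there is a constant $C$ with $|\varphi(p)-\varphi(q)|\le C\,d_\vartheta(p,q)$ for all $p,q\in\mathcal P$ that start at the same vertex. It is a Banach space with the norm $\|\varphi\|_\vartheta=\operatorname{Lip}_1(\varphi)+\|\varphi\|_\infty$, where $\operatorname{Lip}_1(\varphi)$ is the infimum of all $C\ge 0$ such that $|\varphi(p)-\varphi(q)|\le C\,d_\vartheta(p,q)$ for all $p,q\in\mathcal P$ with the same first edge. The transfer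 operator $$(T\varphi)(e_0,e_1,\dots)=\sum_{e\,\frown\, e_0}\varphi(e,e_0,e_1,\dots)$$ is a bounded operator on $L_\vartheta$. Let $\rho$ be its spectral radius on $L_\vartheta$, and let its essential spectral radius $\rho_{\mathrm{ess}}$ be the supremum of $|\lambda|$ (with $\sup\emptyset=0$) over all $\lambda$ in the spectrum of $T$ on $L_\vartheta$ that are not isolated eigenvalues of finite algebraic multiplicity, that is, not isolated points of the spectrum whose spectral (Riesz) projection has finite rank. Then $$\rho_{\mathrm{ess}}\le\vartheta\rho .$$ -/

import Mathlib

open scoped Topology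

/-! ### Non-backtracking paths -/

namespace GraphTransfer

universe u

variable {V : Type u}

/-- Oriented edges `e`, `f` form a turn: `e` ends where `f` starts, and `e` is not `f` reversed. -/
def IsTurn {G : SimpleGraph V} (e f : G.Dart) : Prop :=
  e.snd = f.fst ∧ e ≠ f.symm

/-- The space of infinite edge paths without backtracking. -/
def Ray (G : SimpleGraph V) : Type u :=
  {p : ℕ → G.Dart // ∀ i, IsTurn (p i) (p (i + 1))}

/-- The oriented edges that turn into `f`. -/
def TurnInto {G : SimpleGraph V} (f : G.Dart) : Type u :=
  {e : G.Dart // IsTurn e f}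

instance instFiniteDart (G : SimpleGraph V) [Finite V] : Finite G.Dart :=
  Finite.of_injective (fun e : G.Dart => e.toProd) SimpleGraph.Dart.toProd_injective

noncomputable instance instFintypeTurnInto {G : SimpleGraph V} [Finite V] (f : G.Dart) :
    Fintype (TurnInto f) :=
  @Fintype.ofFinite _ (Subtype.finite)

/-- Prepend an edge to a non-backtracking path. -/
def Ray.cons {G : SimpleGraph V} (p : Ray G) (e : TurnInto (p.1 0)) : Ray G :=
  ⟨fun n => Nat.casesOn n e.1 p.1, fun i => by
    cases i with
    | zero => exact e.2
    | succ k => exact p.2 k⟩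

/-- The transfer operator on the space of all complex functions on paths. -/
noncomputable def transfer (G : SimpleGraph V) [Finite V] :
    (Ray G → ℂ) →ₗ[ℂ] (Ray G → ℂ) where
  toFun φ := fun p => ∑ e : TurnInto (p.1 0), φ (p.cons e)
  map_add' φ ψ := by
    funext p
    simp [Finset.sum_add_distrib]
  map_smul' c φ := by
    funext p
    simp [Finset.mul_sum]

/-! ### The metric and Lipschitz functions -/

open Classical in
/-- The ultrametric `d_ϑ(p, q) = ϑ ^ inf {i | p i ≠ q i}`, which is `0` for `p = q`. -/
noncomputable def rayDist {G : SimpleGraph V} (ϑ : ℝ) (p q : Ray G) : ℝ :=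
  if p = q then 0 else ϑ ^ sInf {i : ℕ | p.1 i ≠ q.1 i}

/-- Both paths start at the same vertex. -/
def SameIsland {G : SimpleGraph V} (p q : Ray G) : Prop := (p.1 0).fst = (q.1 0).fst

/-- Both paths start with the same edge, i.e. they lie in the same district of level one. -/
def SameDistrict {G : SimpleGraph V} (p q : Ray G) : Prop := p.1 0 = q.1 0

/-- `C` is a Lipschitz constant of `φ` for all pairs of paths in the relation `R`. -/
def IsLipConst {G : SimpleGraph V} (ϑ : ℝ) (R : Ray G → Ray G → Prop) (φ : Ray G → ℂ)
    (C : ℝ) : Prop :=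
  0 ≤ C ∧ ∀ p q, R p q → ‖φ p - φ q‖ ≤ C * rayDist ϑ p q

theorem IsLipConst.add {G : SimpleGraph V} {ϑ : ℝ} {R : Ray G → Ray G → Prop}
    {φ ψ : Ray G → ℂ} {C D : ℝ} (h : IsLipConst ϑ R φ C) (k : IsLipConst ϑ R ψ D) :
    IsLipConst ϑ R (φ + ψ) (C + D) := by
  refine ⟨add_nonneg h.1 k.1, fun p q hpq => ?_⟩
  have e : (φ + ψ) p - (φ + ψ) q = (φ p - φ q) + (ψ p - ψ q) := by
    simp only [Pi.add_apply]; ring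
  rw [e, add_mul]
  exact (norm_add_le _ _).trans (add_le_add (h.2 p q hpq) (k.2 p q hpq))

theorem IsLipConst.smul {G : SimpleGraph V} {ϑ : ℝ} {R : Ray G → Ray G → Prop}
    {φ : Ray G → ℂ} {C : ℝ} (c : ℂ) (h : IsLipConst ϑ R φ C) :
    IsLipConst ϑ R (c • φ) (‖c‖ * C) := by
  refine ⟨mul_nonneg (norm_nonneg _) h.1, fun p q hpq => ?_⟩
  have e : (c • φ) p - (c • φ) q = c * (φ p - φ q) := by
    simp only [Pi.smul_apply, smul_eq_mul]; ring
  rw [e, norm_mul, mul_assoc]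
  exact mul_le_mul_of_nonneg_left (h.2 p q hpq) (norm_nonneg _)

/-- Bounded functions that are uniformly `d_ϑ`-Lipschitz on islands. -/
def lipSubmodule (G : SimpleGraph V) (ϑ : ℝ) : Submodule ℂ (Ray G → ℂ) where
  carrier := {φ | (∃ B : ℝ, ∀ p, ‖φ p‖ ≤ B) ∧ ∃ C : ℝ, IsLipConst ϑ SameIsland φ C}
  add_mem' := by
    rintro φ ψ ⟨⟨B, hB⟩, C, hC⟩ ⟨⟨B', hB'⟩, C', hC'⟩
    exact ⟨⟨B + B', fun p => (norm_add_le _ _).trans (add_le_add (hB p) (hB' p))⟩,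
      C + C', hC.add hC'⟩
  zero_mem' := by
    refine ⟨⟨0, fun p => by simp⟩, 0, le_rfl, fun p q _ => by simp⟩
  smul_mem' := by
    rintro c φ ⟨⟨B, hB⟩, C, hC⟩
    refine ⟨⟨‖c‖ * B, fun p => ?_⟩, ‖c‖ * C, hC.smul c⟩
    simpa using mul_le_mul_of_nonneg_left (hB p) (norm_nonneg c)

/-- The Lipschitz space `L_ϑ`.  (A type of its own, so that it carries only the topology of the
norm defined below and not the topology of pointwise convergence.) -/
def LipSpace (G : SimpleGraph V) (ϑ : ℝ) : Type u := ↥(lipSubmodule G ϑ)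

noncomputable instance instAddCommGroupLipSpace (G : SimpleGraph V) (ϑ : ℝ) :
    AddCommGroup (LipSpace G ϑ) :=
  inferInstanceAs (AddCommGroup ↥(lipSubmodule G ϑ))

noncomputable instance instModuleLipSpace (G : SimpleGraph V) (ϑ : ℝ) :
    Module ℂ (LipSpace G ϑ) :=
  inferInstanceAs (Module ℂ ↥(lipSubmodule G ϑ))

/-- The optimal Lipschitz constant on districts of level one. -/
noncomputable def districtLip {G : SimpleGraph V} (ϑ : ℝ) (φ : Ray G → ℂ) : ℝ :=
  sInf {C : ℝ | IsLipConst ϑ SameDistrict φ C}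

/-- The sup-norm. -/
noncomputable def supNorm {G : SimpleGraph V} (φ : Ray G → ℂ) : ℝ := ⨆ p, ‖φ p‖

/-- The norm of `L_ϑ`: optimal Lipschitz constant on districts of level one plus sup-norm. -/
noncomputable instance instNormLipSpace (G : SimpleGraph V) (ϑ : ℝ) : Norm (LipSpace G ϑ) :=
  ⟨fun φ => districtLip ϑ φ.1 + supNorm φ.1⟩

section norm

variable {G : SimpleGraph V} {ϑ : ℝ}

theorem LipSpace.norm_def (φ : LipSpace G ϑ) : ‖φ‖ = districtLip ϑ φ.1 + supNorm φ.1 := rfl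

theorem LipSpace.bddAbove (φ : LipSpace G ϑ) : BddAbove (Set.range fun p => ‖φ.1 p‖) := by
  obtain ⟨B, hB⟩ := φ.2.1
  exact ⟨B, by rintro _ ⟨p, rfl⟩; exact hB p⟩

theorem LipSpace.le_supNorm (φ : LipSpace G ϑ) (p : Ray G) : ‖φ.1 p‖ ≤ supNorm φ.1 :=
  le_ciSup φ.bddAbove p

theorem supNorm_nonneg (φ : Ray G → ℂ) : 0 ≤ supNorm φ :=
  Real.iSup_nonneg fun _ => norm_nonneg _

theorem supNorm_le {φ : Ray G → ℂ} {B : ℝ} (hB : 0 ≤ B) (h : ∀ p, ‖φ p‖ ≤ B) :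
    supNorm φ ≤ B :=
  Real.iSup_le h hB

theorem districtLip_nonneg (φ : Ray G → ℂ) : 0 ≤ districtLip ϑ φ :=
  Real.sInf_nonneg fun _ h => h.1

theorem districtLip_le {φ : Ray G → ℂ} {C : ℝ} (h : IsLipConst ϑ SameDistrict φ C) :
    districtLip ϑ φ ≤ C :=
  csInf_le ⟨0, fun _ h => h.1⟩ h

theorem LipSpace.exists_isLipConst (φ : LipSpace G ϑ) {ε : ℝ} (hε : 0 < ε) :
    ∃ C, IsLipConst ϑ SameDistrict φ.1 C ∧ C < districtLip ϑ φ.1 + ε := by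
  obtain ⟨C, hC⟩ := φ.2.2
  have hne : {C : ℝ | IsLipConst ϑ SameDistrict φ.1 C}.Nonempty :=
    ⟨C, hC.1, fun p q hpq => hC.2 p q (congrArg (fun e : G.Dart => e.fst) hpq)⟩
  obtain ⟨D, hD, hlt⟩ := exists_lt_of_csInf_lt hne (lt_add_of_pos_right _ hε)
  exact ⟨D, hD, hlt⟩

theorem LipSpace.norm_smul_le' (c : ℂ) (φ : LipSpace G ϑ) : ‖c • φ‖ ≤ ‖c‖ * ‖φ‖ := by
  have h1 : supNorm (c • φ).1 ≤ ‖c‖ * supNorm φ.1 := by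
    refine supNorm_le (mul_nonneg (norm_nonneg _) (supNorm_nonneg _)) fun p => ?_
    change ‖c * φ.1 p‖ ≤ _
    rw [norm_mul]
    exact mul_le_mul_of_nonneg_left (φ.le_supNorm p) (norm_nonneg _)
  have h2 : districtLip ϑ (c • φ).1 ≤ ‖c‖ * districtLip ϑ φ.1 := by
    refine le_of_forall_pos_le_add fun ε hε => ?_
    have hpos : 0 < ‖c‖ + 1 := by positivity
    obtain ⟨C, hC, hlt⟩ := φ.exists_isLipConst (div_pos hε hpos)
    have h3 : districtLip ϑ (c • φ).1 ≤ ‖c‖ * C := districtLip_le (hC.smul c)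
    have h4 : ‖c‖ * C ≤ ‖c‖ * (districtLip ϑ φ.1 + ε / (‖c‖ + 1)) :=
      mul_le_mul_of_nonneg_left hlt.le (norm_nonneg _)
    have h5 : ‖c‖ * (ε / (‖c‖ + 1)) ≤ ε := by
      rw [mul_div_assoc', div_le_iff₀ hpos]
      nlinarith [norm_nonneg c]
    linarith [mul_add ‖c‖ (districtLip ϑ φ.1) (ε / (‖c‖ + 1))]
  rw [LipSpace.norm_def, LipSpace.norm_def, mul_add]
  exact add_le_add h2 h1

theorem lipSpaceCore : NormedSpace.Core ℂ (LipSpace G ϑ) where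
  norm_nonneg φ := add_nonneg (districtLip_nonneg _) (supNorm_nonneg _)
  norm_smul c φ := by
    refine le_antisymm (LipSpace.norm_smul_le' c φ) ?_
    by_cases hc : c = 0
    · subst hc
      rw [norm_zero, zero_mul]
      exact add_nonneg (districtLip_nonneg _) (supNorm_nonneg _)
    · have h := LipSpace.norm_smul_le' c⁻¹ (c • φ)
      rw [smul_smul, inv_mul_cancel₀ hc, one_smul, norm_inv] at h
      have hpos : 0 < ‖c‖ := norm_pos_iff.mpr hc
      calc ‖c‖ * ‖φ‖ ≤ ‖c‖ * (‖c‖⁻¹ * ‖c • φ‖) := mul_le_mul_of_nonneg_left h hpos.le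
        _ = ‖c • φ‖ := by rw [← mul_assoc, mul_inv_cancel₀ hpos.ne', one_mul]
  norm_triangle φ ψ := by
    have h1 : supNorm (φ + ψ).1 ≤ supNorm φ.1 + supNorm ψ.1 := by
      refine supNorm_le (add_nonneg (supNorm_nonneg _) (supNorm_nonneg _)) fun p => ?_
      exact (norm_add_le (φ.1 p) (ψ.1 p)).trans (add_le_add (φ.le_supNorm p) (ψ.le_supNorm p))
    have h2 : districtLip ϑ (φ + ψ).1 ≤ districtLip ϑ φ.1 + districtLip ϑ ψ.1 := by
      refine le_of_forall_pos_le_add fun ε hε => ?_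
      obtain ⟨C, hC, hC'⟩ := φ.exists_isLipConst (half_pos hε)
      obtain ⟨D, hD, hD'⟩ := ψ.exists_isLipConst (half_pos hε)
      have h3 : districtLip ϑ (φ + ψ).1 ≤ C + D := districtLip_le (hC.add hD)
      linarith
    simp only [LipSpace.norm_def]
    linarith
  norm_eq_zero_iff φ := by
    constructor
    · intro h
      have h0 : supNorm φ.1 = 0 := by
        have h1 := districtLip_nonneg (ϑ := ϑ) φ.1
        have h2 := supNorm_nonneg φ.1
        rw [LipSpace.norm_def] at h
        linarith
      refine Subtype.ext (funext fun p => ?_)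
      have h3 := φ.le_supNorm p
      rw [h0] at h3
      exact norm_le_zero_iff.mp h3
    · rintro rfl
      have h1 := LipSpace.norm_smul_le' (0 : ℂ) (0 : LipSpace G ϑ)
      rw [smul_zero, norm_zero, zero_mul] at h1
      exact le_antisymm h1 (add_nonneg (districtLip_nonneg _) (supNorm_nonneg _))

end norm

noncomputable instance instNormedAddCommGroupLipSpace (G : SimpleGraph V) (ϑ : ℝ) :
    NormedAddCommGroup (LipSpace G ϑ) :=
  NormedAddCommGroup.ofCore lipSpaceCore

noncomputable instance instNormedSpaceLipSpace (G : SimpleGraph V) (ϑ : ℝ) :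
    NormedSpace ℂ (LipSpace G ϑ) :=
  NormedSpace.ofCore lipSpaceCore

/-! ### The transfer operator on the Lipschitz space -/

section transfer

variable {G : SimpleGraph V} {ϑ : ℝ}

theorem rayDist_nonneg (h : 0 < ϑ) (p q : Ray G) : 0 ≤ rayDist ϑ p q := by
  unfold rayDist
  split_ifs
  · exact le_rfl
  · exact (pow_pos h _).le

theorem rayDist_of_ne (p q : Ray G) (h : p.1 0 ≠ q.1 0) : rayDist ϑ p q = 1 := by
  have hpq : p ≠ q := fun e => h (by rw [e])
  have h0 : sInf {i : ℕ | p.1 i ≠ q.1 i} = 0 := Nat.sInf_eq_zero.mpr (Or.inl h)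
  rw [rayDist, if_neg hpq, h0, pow_zero]

/-- Prepending the same edge to two paths contracts distances by at least the factor `ϑ`. -/
theorem rayDist_cons_le (h : 0 < ϑ) (p q p' q' : Ray G) (h0 : p'.1 0 = q'.1 0)
    (hp : ∀ i, p'.1 (i + 1) = p.1 i) (hq : ∀ i, q'.1 (i + 1) = q.1 i) :
    rayDist ϑ p' q' ≤ ϑ * rayDist ϑ p q := by
  by_cases hpq : p = q
  · have : p' = q' := by
      refine Subtype.ext (funext fun i => ?_)
      cases i with
      | zero => exact h0
      | succ k => rw [hp, hq, hpq]
    rw [rayDist, if_pos this]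
    exact mul_nonneg h.le (rayDist_nonneg h p q)
  · have hne : p' ≠ q' := by
      rintro rfl
      exact hpq (Subtype.ext (funext fun i => by rw [← hp, ← hq]))
    have hS : {i : ℕ | p.1 i ≠ q.1 i}.Nonempty := by
      by_contra hS
      exact hpq (Subtype.ext (funext fun i => by
        by_contra hi
        exact hS ⟨i, hi⟩))
    have hinf : sInf {i : ℕ | p'.1 i ≠ q'.1 i} = sInf {i : ℕ | p.1 i ≠ q.1 i} + 1 := by
      refine le_antisymm (Nat.sInf_le ?_) (le_csInf ?_ ?_)
      · change p'.1 (_ + 1) ≠ q'.1 (_ + 1)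
        rw [hp, hq]
        exact Nat.sInf_mem hS
      · obtain ⟨i, hi⟩ := hS
        exact ⟨i + 1, by change p'.1 (_ + 1) ≠ q'.1 (_ + 1); rw [hp, hq]; exact hi⟩
      · intro b hb
        cases b with
        | zero => exact absurd h0 hb
        | succ k =>
          refine Nat.succ_le_succ (Nat.sInf_le ?_)
          change p'.1 (k + 1) ≠ q'.1 (k + 1) at hb
          rwa [hp, hq] at hb
    rw [rayDist, if_neg hne, rayDist, if_neg hpq, hinf, pow_succ, mul_comm]

variable [Finite V]

theorem card_turnInto_le (f : G.Dart) : (Fintype.card (TurnInto f) : ℝ) ≤ Nat.card G.Dart := by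
  rw [← Nat.card_eq_fintype_card]
  exact_mod_cast Nat.card_le_card_of_injective (fun e : TurnInto f => e.1) Subtype.val_injective

theorem norm_transfer_le (φ : Ray G → ℂ) {B : ℝ} (hB : 0 ≤ B) (h : ∀ p, ‖φ p‖ ≤ B)
    (p : Ray G) : ‖transfer G φ p‖ ≤ Nat.card G.Dart * B := by
  calc ‖transfer G φ p‖ ≤ ∑ e : TurnInto (p.1 0), ‖φ (p.cons e)‖ := norm_sum_le _ _
    _ ≤ ∑ _e : TurnInto (p.1 0), B := Finset.sum_le_sum fun e _ => h _
    _ = Fintype.card (TurnInto (p.1 0)) * B := by simp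
    _ ≤ Nat.card G.Dart * B := mul_le_mul_of_nonneg_right (card_turnInto_le _) hB

theorem isLipConst_transfer (hϑ : 0 < ϑ) {φ : Ray G → ℂ} {C : ℝ}
    (h : IsLipConst ϑ SameDistrict φ C) :
    IsLipConst ϑ SameDistrict (transfer G φ) (Nat.card G.Dart * (C * ϑ)) := by
  have hC : 0 ≤ C * ϑ := mul_nonneg h.1 hϑ.le
  refine ⟨mul_nonneg (Nat.cast_nonneg _) hC, ?_⟩
  rintro p ⟨q, hq⟩ hpq
  change p.1 0 = q 0 at hpq
  have key : ∀ (f : G.Dart) (hf : p.1 0 = f) (hf' : q 0 = f),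
      ‖transfer G φ p - transfer G φ ⟨q, hq⟩‖ ≤
        Nat.card G.Dart * (C * ϑ) * rayDist ϑ p ⟨q, hq⟩ := by
    intro f hf hf'
    have e1 : transfer G φ p = ∑ e : TurnInto f, φ (p.cons ⟨e.1, hf ▸ e.2⟩) := by
      subst hf; rfl
    have e2 : transfer G φ ⟨q, hq⟩ =
        ∑ e : TurnInto f, φ (Ray.cons ⟨q, hq⟩ ⟨e.1, hf' ▸ e.2⟩) := by
      subst hf'; rfl
    rw [e1, e2, ← Finset.sum_sub_distrib]
    have hd := rayDist_nonneg hϑ p ⟨q, hq⟩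
    calc _ ≤ ∑ e : TurnInto f, ‖φ (p.cons ⟨e.1, hf ▸ e.2⟩) -
              φ (Ray.cons ⟨q, hq⟩ ⟨e.1, hf' ▸ e.2⟩)‖ := norm_sum_le _ _
      _ ≤ ∑ _e : TurnInto f, (C * ϑ) * rayDist ϑ p ⟨q, hq⟩ := by
          refine Finset.sum_le_sum fun e _ => ?_
          refine (h.2 (p.cons ⟨e.1, hf ▸ e.2⟩) (Ray.cons ⟨q, hq⟩ ⟨e.1, hf' ▸ e.2⟩) rfl).trans ?_
          rw [mul_assoc]
          exact mul_le_mul_of_nonneg_left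
            (rayDist_cons_le hϑ p ⟨q, hq⟩ _ _ rfl (fun _ => rfl) (fun _ => rfl)) h.1
      _ = Fintype.card (TurnInto f) * ((C * ϑ) * rayDist ϑ p ⟨q, hq⟩) := by simp
      _ ≤ Nat.card G.Dart * ((C * ϑ) * rayDist ϑ p ⟨q, hq⟩) :=
          mul_le_mul_of_nonneg_right (card_turnInto_le _) (mul_nonneg hC hd)
      _ = _ := by ring
  exact key (q 0) hpq rfl

theorem transfer_mem (hϑ : 0 < ϑ) (φ : LipSpace G ϑ) : transfer G φ.1 ∈ lipSubmodule G ϑ := by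
  obtain ⟨C, hC, -⟩ := φ.exists_isLipConst one_pos
  have hD := isLipConst_transfer hϑ hC
  have hb := norm_transfer_le φ.1 (supNorm_nonneg _) φ.le_supNorm
  set B : ℝ := Nat.card G.Dart * supNorm φ.1
  have hB : 0 ≤ B := mul_nonneg (Nat.cast_nonneg _) (supNorm_nonneg _)
  set D : ℝ := Nat.card G.Dart * (C * ϑ)
  refine ⟨⟨B, hb⟩, D + 2 * B, by linarith [hD.1], fun p q _ => ?_⟩
  by_cases hpq : p.1 0 = q.1 0
  · refine (hD.2 p q hpq).trans (mul_le_mul_of_nonneg_right ?_ (rayDist_nonneg hϑ p q))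
    linarith
  · rw [rayDist_of_ne p q hpq, mul_one]
    have := norm_sub_le (transfer G φ.1 p) (transfer G φ.1 q)
    linarith [hb p, hb q, hD.1]

end transfer

/-- The transfer operator as a bounded operator on `L_ϑ`: the restriction of `transfer G`. -/
noncomputable def lipTransfer (G : SimpleGraph V) [Finite V] (ϑ : ℝ) (hϑ : 0 < ϑ) :
    LipSpace G ϑ →L[ℂ] LipSpace G ϑ :=
  LinearMap.mkContinuous
    { toFun := fun φ => ⟨transfer G φ.1, transfer_mem hϑ φ⟩
      map_add' := fun φ ψ => Subtype.ext ((transfer G).map_add φ.1 ψ.1)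
      map_smul' := fun c φ => Subtype.ext ((transfer G).map_smul c φ.1) }
    (Nat.card G.Dart * (ϑ + 1)) (by
      intro φ
      have h1 : supNorm (transfer G φ.1) ≤ Nat.card G.Dart * supNorm φ.1 :=
        supNorm_le (mul_nonneg (Nat.cast_nonneg _) (supNorm_nonneg _))
          (norm_transfer_le φ.1 (supNorm_nonneg _) φ.le_supNorm)
      have hN : (0 : ℝ) ≤ Nat.card G.Dart := Nat.cast_nonneg _
      have h2 : districtLip ϑ (transfer G φ.1) ≤ Nat.card G.Dart * (districtLip ϑ φ.1 * ϑ) := by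
        refine le_of_forall_pos_le_add fun ε hε => ?_
        have hpos : 0 < Nat.card G.Dart * ϑ + 1 := by positivity
        obtain ⟨C, hC, hlt⟩ := φ.exists_isLipConst (div_pos hε hpos)
        refine (districtLip_le (isLipConst_transfer hϑ hC)).trans ?_
        have h3 : Nat.card G.Dart * ϑ * (ε / (Nat.card G.Dart * ϑ + 1)) ≤ ε := by
          rw [mul_div_assoc', div_le_iff₀ hpos]
          nlinarith
        have h4 : Nat.card G.Dart * ϑ * C ≤ Nat.card G.Dart * ϑ *
            (districtLip ϑ φ.1 + ε / (Nat.card G.Dart * ϑ + 1)) :=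
          mul_le_mul_of_nonneg_left hlt.le (mul_nonneg hN hϑ.le)
        linarith
      change districtLip ϑ (transfer G φ.1) + supNorm (transfer G φ.1) ≤
        Nat.card G.Dart * (ϑ + 1) * (districtLip ϑ φ.1 + supNorm φ.1)
      have h5 := districtLip_nonneg (ϑ := ϑ) φ.1
      have h6 := supNorm_nonneg φ.1
      have h7 := mul_nonneg hN h5
      have h8 := mul_nonneg (mul_nonneg hN hϑ.le) h6
      linarith)

/-! ### The essential spectral radius -/

section essential

variable {E : Type*} [NormedAddCommGroup E] [NormedSpace ℂ E]

/-- `z` is an isolated eigenvalue of finite algebraic multiplicity of the bounded operator `T`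
on a Banach space: it is an isolated point of the spectrum, the space of generalized eigenvectors
is finite-dimensional, and it has a closed invariant complement on which `T - z` is invertible
(equivalently, the spectral projection of `T` at `z` has finite rank). -/
def IsDiscreteEigenvalue (T : E →L[ℂ] E) (z : ℂ) : Prop :=
  z ∈ spectrum ℂ T ∧
  (∀ᶠ w in 𝓝[≠] z, w ∉ spectrum ℂ T) ∧
  Module.End.HasEigenvalue (T : Module.End ℂ E) z ∧
  FiniteDimensional ℂ (Module.End.maxGenEigenspace (T : Module.End ℂ E) z) ∧
  ∃ N : Submodule ℂ E, IsClosed (N : Set E) ∧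
    IsCompl (Module.End.maxGenEigenspace (T : Module.End ℂ E) z) N ∧
    Set.BijOn (fun x => T x - z • x) N N

/-- The essential spectrum: all spectral values except the isolated eigenvalues of finite
algebraic multiplicity. -/
def essentialSpectrum (T : E →L[ℂ] E) : Set ℂ :=
  {z ∈ spectrum ℂ T | ¬ IsDiscreteEigenvalue T z}

/-- The essential spectral radius: the supremum of `|z|` over the essential spectrum, i.e. the
radius of the smallest closed disc around `0` outside of which the spectrum consists of isolated
eigenvalues of finite algebraic multiplicity. -/
noncomputable def essentialSpectralRadius (T : E →L[ℂ] E) : ENNReal :=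
  ⨆ z ∈ essentialSpectrum T, (‖z‖₊ : ENNReal)

end essential

end GraphTransfer

/-! Write `T` for the transfer operator and let `F` be the space of functions of the first edge
alone; it is finite-dimensional and `T`-invariant. Let `P` replace a function by its values at one
chosen path in each cylinder of depth `n`. Each application of `T` prepends an edge, so it uses up
one level of dependence and contracts distances by `ϑ`. Hence `T ^ n P` maps into `F`, while `R = T
^ n (1 - P)` vanishes on `F` and has norm at most `2 ϑ ^ n ‖T ^ n‖`
(`norm_lipTransfer_pow_sub_cylinderApprox_le`).

If `|w| > ϑρ`, Gelfand's formula gives an `n` with `‖R‖ < |w| ^ n`. Then `R - w ^ n` is invertible,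
and since `T ^ n` and `R` agree modulo `F`, factoring `T ^ n - w ^ n` through `T - w` shows that `T
- w` is bijective modulo `F` (`bijective_mod_of_pow_approx`).

Outside the disc of radius `ϑρ` the spectrum therefore consists of eigenvalues of the matrix `T|F`,
so it is finite there. The Fitting decomposition of `T|F` lifts to the whole space and supplies the
finite-dimensional generalized eigenspace with its closed invariant complement
(`isDiscreteEigenvalue_of_bijective_mod`). -/

open Filter

namespace GraphTransfer

/-! ### Linear algebra modulo a finite-dimensional invariant subspace. -/

section Fitting

variable {K E : Type*} [Field K] [AddCommGroup E] [Module K E]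

theorem mem_of_pow_apply_mem {S : Module.End K E} {F : Submodule K E}
    (hinj : ∀ x, S x ∈ F → x ∈ F) (m : ℕ) {x : E} (hx : (S ^ m) x ∈ F) : x ∈ F := by
  induction m with
  | zero => simpa using hx
  | succ m ih =>
    rw [pow_succ', Module.End.mul_apply] at hx
    exact ih (hinj _ hx)

theorem exists_sub_pow_apply_mem {S : Module.End K E} {F : Submodule K E}
    (hSF : ∀ x ∈ F, S x ∈ F) (hsurj : ∀ y, ∃ x, y - S x ∈ F) (m : ℕ) (y : E) :
    ∃ x, y - (S ^ m) x ∈ F := by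
  induction m generalizing y with
  | zero => exact ⟨y, by simp⟩
  | succ m ih =>
    obtain ⟨x, hx⟩ := hsurj y
    obtain ⟨x', hx'⟩ := ih x
    refine ⟨x', ?_⟩
    have h := F.add_mem hx (hSF _ hx')
    rw [map_sub] at h
    rw [pow_succ', Module.End.mul_apply]
    simpa using h

/-- Fitting decomposition of an endomorphism that is bijective modulo a finite-dimensional
invariant subspace. -/
theorem exists_fitting (S : Module.End K E) (F : Submodule K E) [FiniteDimensional K F]
    (hSF : ∀ x ∈ F, S x ∈ F) (hinj : ∀ x, S x ∈ F → x ∈ F)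
    (hsurj : ∀ y, ∃ x, y - S x ∈ F) :
    ∃ k, 1 ≤ k ∧ (∀ m x, (S ^ m) x = 0 → (S ^ k) x = 0) ∧ LinearMap.ker (S ^ k) ≤ F ∧
      IsCompl (LinearMap.ker (S ^ k)) (LinearMap.range (S ^ k)) := by
  set A : Module.End K F := S.restrict hSF
  have hA : ∀ (m : ℕ) (x : F), (((A ^ m) x : F) : E) = (S ^ m) x := by
    intro m x
    induction m with
    | zero => simp
    | succ m ih => rw [pow_succ', pow_succ', Module.End.mul_apply, Module.End.mul_apply, ← ih]; rfl
  -- Past some exponent the kernels of the powers of `A` are stationary and Fitting's lemma holds on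
  -- `F`; `1 ≤ k` is needed later in `bijOn_range_pow`.
  obtain ⟨k, hk, hcompl, hker⟩ := ((eventually_ge_atTop 1).and
    ((LinearMap.eventually_isCompl_ker_pow_range_pow A).and
      (LinearMap.eventually_iSup_ker_pow_eq A))).exists
  have hmem : ∀ m x, (S ^ m) x = 0 → x ∈ F := fun m x hx =>
    mem_of_pow_apply_mem hinj m (by rw [hx]; exact F.zero_mem)
  have hstab : ∀ m x, (S ^ m) x = 0 → (S ^ k) x = 0 := by
    intro m x hx
    have h1 : (⟨x, hmem m x hx⟩ : F) ∈ LinearMap.ker (A ^ m) :=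
      LinearMap.mem_ker.mpr (Subtype.ext ((hA _ _).trans hx))
    have h2 := (le_iSup (fun m => LinearMap.ker (A ^ m)) m) h1
    rw [hker] at h2
    exact (hA k ⟨x, hmem m x hx⟩).symm.trans (congrArg Subtype.val (LinearMap.mem_ker.mp h2))
  refine ⟨k, hk, hstab, fun x hx => hmem k x hx, ?_, ?_⟩
  · rw [Submodule.disjoint_def]
    rintro _ hx ⟨y, rfl⟩
    rw [LinearMap.mem_ker, ← Module.End.mul_apply, ← pow_add] at hx
    exact hstab _ _ hx
  · rw [codisjoint_iff, eq_top_iff]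
    intro y _
    -- Surjectivity modulo `F` moves `y` into `F` up to an element of the range of `S ^ k`; there
    -- the decomposition for `A` applies.
    obtain ⟨x, hx⟩ := exists_sub_pow_apply_mem hSF hsurj k y
    have h1 : (⟨_, hx⟩ : F) ∈ LinearMap.ker (A ^ k) ⊔ LinearMap.range (A ^ k) := by
      rw [hcompl.sup_eq_top]; trivial
    obtain ⟨a, ha, b, ⟨c, rfl⟩, hab⟩ := Submodule.mem_sup.mp h1
    refine Submodule.mem_sup.mpr ⟨a, ?_, (S ^ k) (c + x), ⟨_, rfl⟩, ?_⟩
    · exact LinearMap.mem_ker.mpr ((hA k a).symm.trans (congrArg Subtype.val ha))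
    · have h2 := congrArg Subtype.val hab
      simp only [Submodule.coe_add, hA] at h2
      rw [map_add, ← add_assoc, h2, sub_add_cancel]

theorem bijOn_range_pow {S : Module.End K E} {k : ℕ} (hk : 1 ≤ k)
    (h : IsCompl (LinearMap.ker (S ^ k)) (LinearMap.range (S ^ k))) :
    Set.BijOn S (LinearMap.range (S ^ k)) (LinearMap.range (S ^ k)) := by
  obtain ⟨j, rfl⟩ := Nat.exists_eq_add_of_le' hk
  refine ⟨?_, ?_, ?_⟩
  · rintro _ ⟨y, rfl⟩
    exact ⟨S y, by rw [← Module.End.mul_apply, ← Module.End.mul_apply, ← pow_succ, ← pow_succ']⟩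
  · intro x hx y hy hxy
    refine sub_eq_zero.mp (Submodule.disjoint_def.mp h.disjoint _ ?_ (Submodule.sub_mem _ hx hy))
    rw [LinearMap.mem_ker, pow_succ, Module.End.mul_apply, map_sub, hxy, sub_self, map_zero]
  · rintro _ ⟨y, rfl⟩
    obtain ⟨a, ha, b, ⟨c, rfl⟩, rfl⟩ := Submodule.mem_sup.mp
      (h.sup_eq_top ▸ Submodule.mem_top : y ∈ LinearMap.ker (S ^ (j + 1)) ⊔
        LinearMap.range (S ^ (j + 1)))
    refine ⟨(S ^ (j + 1)) ((S ^ j) c), ⟨_, rfl⟩, ?_⟩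
    rw [map_add, LinearMap.mem_ker.mp ha, zero_add, ← Module.End.mul_apply,
      ← Module.End.mul_apply, ← Module.End.mul_apply, ← pow_succ', ← pow_add, ← pow_add]
    congr 2
    omega

/-- The kernel of `S` lies in `F`. If it is trivial, `S` restricted to `F` is injective, hence
surjective by finite dimension, and surjectivity modulo `F` becomes surjectivity. -/
theorem hasEigenvalue_or_bijective (S : Module.End K E) (F : Submodule K E)
    [FiniteDimensional K F] (hSF : ∀ x ∈ F, S x ∈ F) (hinj : ∀ x, S x ∈ F → x ∈ F)
    (hsurj : ∀ y, ∃ x, y - S x ∈ F) :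
    (∃ x ∈ F, x ≠ 0 ∧ S x = 0) ∨ Function.Bijective S := by
  by_cases h : ∃ x ∈ F, x ≠ 0 ∧ S x = 0
  · exact Or.inl h
  · push Not at h
    have hker : ∀ x, S x = 0 → x = 0 := fun x hx => by
      by_contra hx0
      exact h x (hinj x (by rw [hx]; exact F.zero_mem)) hx0 hx
    have hS : Function.Injective S := (injective_iff_map_eq_zero S).mpr hker
    have hA : Function.Surjective (S.restrict hSF) :=
      LinearMap.injective_iff_surjective.mp fun x y hxy =>
        Subtype.ext (hS (congrArg Subtype.val hxy))
    refine Or.inr ⟨hS, fun y => ?_⟩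
    obtain ⟨x, hx⟩ := hsurj y
    obtain ⟨f, hf⟩ := hA ⟨_, hx⟩
    have hf' : S f = y - S x := congrArg Subtype.val hf
    exact ⟨f + x, by rw [map_add, hf', sub_add_cancel]⟩

end Fitting

/-! ### Spectral criterion for discrete eigenvalues. -/

section Discrete

variable {E : Type*} [NormedAddCommGroup E] [NormedSpace ℂ E] [CompleteSpace E]

/-- The finite-dimensional kernel has a closed complement `W`. Restricted to `W`, `f` is injective
with unchanged range, and this range has a closed complement, namely the kernel; for a bounded
operator between Banach spaces this forces closed range. -/
theorem isClosed_range_of_isCompl_ker (f : E →L[ℂ] E)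
    [FiniteDimensional ℂ (LinearMap.ker (f : E →ₗ[ℂ] E))]
    (h : IsCompl (LinearMap.ker (f : E →ₗ[ℂ] E)) (LinearMap.range (f : E →ₗ[ℂ] E))) :
    IsClosed (LinearMap.range (f : E →ₗ[ℂ] E) : Set E) := by
  obtain ⟨W, hW, hcompl⟩ := (Submodule.ClosedComplemented.of_finiteDimensional (𝕜 := ℂ)
    (LinearMap.ker (f : E →ₗ[ℂ] E))).exists_isClosed_isCompl
  have : CompleteSpace W := hW.completeSpace_coe
  have hrange : LinearMap.range ((f ∘L W.subtypeL : W →L[ℂ] E) : W →ₗ[ℂ] E) =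
      LinearMap.range (f : E →ₗ[ℂ] E) := by
    refine le_antisymm ?_ ?_
    · rintro _ ⟨w, rfl⟩
      exact ⟨w, rfl⟩
    · rintro _ ⟨y, rfl⟩
      obtain ⟨a, ha, b, hb, rfl⟩ := Submodule.mem_sup.mp
        (hcompl.sup_eq_top ▸ Submodule.mem_top : y ∈ LinearMap.ker (f : E →ₗ[ℂ] E) ⊔ W)
      exact ⟨⟨b, hb⟩, by rw [map_add, LinearMap.mem_ker.mp ha, zero_add]; rfl⟩
  have key := (f ∘L W.subtypeL).closed_complemented_range_of_isCompl_of_ker_eq_bot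
    (LinearMap.ker (f : E →ₗ[ℂ] E)) (by rw [hrange]; exact h.symm)
    (Submodule.closed_of_finiteDimensional _) (by
      rw [LinearMap.ker_eq_bot']
      intro w hw
      exact Subtype.ext (Submodule.disjoint_def.mp hcompl.disjoint _ hw w.2))
  rwa [hrange] at key

/-- If `T` has a finite-dimensional invariant subspace modulo which `T - w` is bijective for all
`w` in an open set `U`, then the spectrum of `T` in `U` is discrete. -/
theorem isDiscreteEigenvalue_of_bijective_mod (T : E →L[ℂ] E) (F : Submodule ℂ E)
    [FiniteDimensional ℂ F] (hTF : ∀ x ∈ F, T x ∈ F) {U : Set ℂ} (hU : IsOpen U)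
    (hinj : ∀ w ∈ U, ∀ x, T x - w • x ∈ F → x ∈ F)
    (hsurj : ∀ w ∈ U, ∀ y, ∃ x, y - (T x - w • x) ∈ F)
    {z : ℂ} (hzU : z ∈ U) (hz : z ∈ spectrum ℂ T) : IsDiscreteEigenvalue T z := by
  have hSF : ∀ w : ℂ, ∀ x ∈ F, ((T : Module.End ℂ E) - w • 1) x ∈ F := fun w x hx =>
    F.sub_mem (hTF x hx) (F.smul_mem w hx)
  have hspec : ∀ w ∈ U, w ∈ spectrum ℂ T → ∃ x ∈ F, x ≠ 0 ∧ T x = w • x := by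
    intro w hw hws
    rcases hasEigenvalue_or_bijective ((T : Module.End ℂ E) - w • 1) F (hSF w) (hinj w hw)
      (hsurj w hw) with ⟨x, hxF, hx0, hx⟩ | hbij
    · exact ⟨x, hxF, hx0, sub_eq_zero.mp hx⟩
    · refine absurd ?_ (spectrum.mem_iff.mp hws)
      rw [← IsUnit.neg_iff, neg_sub, ContinuousLinearMap.isUnit_iff_bijective]
      exact hbij
  -- Every spectral value in `U` has an eigenvector in `F`, so it is one of the finitely many
  -- eigenvalues of `T` on `F`.
  have hfin : (U ∩ spectrum ℂ T).Finite := by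
    refine (Module.End.finite_hasEigenvalue
      ((T : Module.End ℂ E).restrict hTF)).subset ?_
    rintro w ⟨hw, hws⟩
    obtain ⟨x, hxF, hx0, hx⟩ := hspec w hw hws
    refine Module.End.hasEigenvalue_of_hasEigenvector (x := ⟨x, hxF⟩)
      (Module.End.hasEigenvector_iff.mpr ⟨Module.End.mem_eigenspace_iff.mpr (Subtype.ext hx), ?_⟩)
    exact fun h => hx0 (congrArg Subtype.val h)
  obtain ⟨x, -, hx0, hx⟩ := hspec z hzU hz
  obtain ⟨k, hk, hstab, hkerF, hcompl⟩ := exists_fitting ((T : Module.End ℂ E) - z • 1) F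
    (hSF z) (hinj z hzU) (hsurj z hzU)
  have hmax : Module.End.maxGenEigenspace (T : Module.End ℂ E) z =
      LinearMap.ker (((T : Module.End ℂ E) - z • 1) ^ k) := by
    ext y
    rw [Module.End.mem_maxGenEigenspace]
    exact ⟨fun ⟨m, hm⟩ => hstab m y hm, fun hy => ⟨k, hy⟩⟩
  have hfd : FiniteDimensional ℂ (LinearMap.ker (((T : Module.End ℂ E) - z • 1) ^ k)) :=
    Submodule.finiteDimensional_of_le hkerF
  have hcoe : (((T - z • 1) ^ k : E →L[ℂ] E) : E →ₗ[ℂ] E) =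
      ((T : Module.End ℂ E) - z • 1) ^ k := by
    ext y
    rw [ContinuousLinearMap.toLinearMap_pow]
    rfl
  refine ⟨hz, ?_, Module.End.hasEigenvalue_of_hasEigenvector (x := x)
    (Module.End.hasEigenvector_iff.mpr ⟨Module.End.mem_eigenspace_iff.mpr hx, hx0⟩), ?_,
    LinearMap.range (((T : Module.End ℂ E) - z • 1) ^ k), ?_, ?_, bijOn_range_pow hk hcompl⟩
  · have h1 : ∀ᶠ w in 𝓝[≠] z, w ∉ (U ∩ spectrum ℂ T) \ {z} :=
      nhdsWithin_le_nhds ((hfin.subset Set.sdiff_subset).isClosed.isOpen_compl.mem_nhds (by simp))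
    filter_upwards [h1, nhdsWithin_le_nhds (hU.mem_nhds hzU), self_mem_nhdsWithin] with w h2 h3 h4 h5
    exact h2 ⟨⟨h3, h5⟩, h4⟩
  · rw [hmax]; exact hfd
  · rw [← hcoe] at hfd hcompl ⊢
    exact isClosed_range_of_isCompl_ker _ hcompl
  · rw [hmax]; exact hcompl

/-- A power of `T` that agrees, modulo an invariant subspace `F`, with a small operator vanishing
on `F` forces `T - w` to be bijective modulo `F`. -/
theorem bijective_mod_of_pow_approx (T R : E →L[ℂ] E) (F : Submodule ℂ E)
    (hTF : ∀ x ∈ F, T x ∈ F) (hRF : ∀ x ∈ F, R x = 0) (n : ℕ)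
    (hTR : ∀ x, (T ^ n) x - R x ∈ F) {w : ℂ} (hw : ‖R‖ < ‖w‖ ^ n) :
    (∀ x, T x - w • x ∈ F → x ∈ F) ∧ ∀ y, ∃ x, y - (T x - w • x) ∈ F := by
  have hw0 : w ^ n ≠ 0 := by
    rw [← norm_pos_iff, norm_pow]
    exact (norm_nonneg R).trans_lt hw
  have hres : Function.Bijective (R - w ^ n • 1 : E →L[ℂ] E) := by
    rw [← ContinuousLinearMap.isUnit_iff_bijective, ← IsUnit.neg_iff, neg_sub]
    refine spectrum.mem_resolventSet_of_norm_lt_mul (lt_of_le_of_lt ?_ (hw.trans_eq (norm_pow w n).symm))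
    exact (mul_le_mul_of_nonneg_left ContinuousLinearMap.norm_id_le (norm_nonneg _)).trans_eq
      (mul_one _)
  -- The cofactor in `T ^ n - w ^ n = (T - w) Q = Q (T - w)`; it preserves `F`. The left identity
  -- gives surjectivity modulo `F`, the right one injectivity.
  set Q : E →L[ℂ] E := ∑ i ∈ Finset.range n, T ^ i * (w • 1) ^ (n - 1 - i) with hQ
  have hcomm : Commute T (w • 1 : E →L[ℂ] E) := (Commute.one_right T).smul_right w
  have hfac1 : (T - w • 1) * Q = T ^ n - w ^ n • 1 := by
    rw [hQ, hcomm.mul_geom_sum₂, smul_pow, one_pow]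
  have hfac2 : Q * (T - w • 1) = T ^ n - w ^ n • 1 := by
    rw [hQ, hcomm.geom_sum₂_mul, smul_pow, one_pow]
  have hTn : ∀ i : ℕ, ∀ x ∈ F, (T ^ i) x ∈ F := by
    intro i
    induction i with
    | zero => exact fun x hx => by simpa using hx
    | succ i ih =>
      intro x hx
      rw [pow_succ]
      exact ih _ (hTF x hx)
  have hQF : ∀ x ∈ F, Q x ∈ F := by
    intro x hx
    rw [hQ, sum_apply]
    refine F.sum_mem fun i _ => ?_
    rw [smul_pow, one_pow, mul_smul_comm, mul_one]
    exact F.smul_mem _ (hTn i x hx)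
  constructor
  · intro x hx
    have h1 : (T ^ n - w ^ n • 1 : E →L[ℂ] E) x ∈ F := by
      rw [← hfac2]; exact hQF _ hx
    have h2 : (R - w ^ n • 1 : E →L[ℂ] E) x ∈ F := by
      have := F.sub_mem h1 (hTR x)
      have e : (T ^ n - w ^ n • 1 : E →L[ℂ] E) x - ((T ^ n) x - R x) =
        (R - w ^ n • 1 : E →L[ℂ] E) x := by
        change (T ^ n) x - w ^ n • x - ((T ^ n) x - R x) = R x - w ^ n • x
        abel
      rwa [e] at this
    set f := (R - w ^ n • 1 : E →L[ℂ] E) x with hf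
    -- Since `R` kills `F`, `R - w ^ n` acts on `f` as the scalar `-w ^ n`. Its injectivity then
    -- identifies `x` with a multiple of `f`.
    have h3 : (R - w ^ n • 1 : E →L[ℂ] E) (-(w ^ n)⁻¹ • f) = f := by
      change R (-(w ^ n)⁻¹ • f) - w ^ n • (-(w ^ n)⁻¹ • f) = f
      rw [map_smul, hRF f h2, smul_smul, mul_neg, mul_inv_cancel₀ hw0]
      simp
    rw [← hres.1 (h3.trans hf)]
    exact F.smul_mem _ h2
  · intro y
    obtain ⟨x, rfl⟩ := hres.2 y
    refine ⟨Q x, ?_⟩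
    have h1 : T (Q x) - w • Q x = (T ^ n) x - w ^ n • x :=
      DFunLike.congr_fun hfac1 x
    rw [h1]
    have e : (R - w ^ n • 1 : E →L[ℂ] E) x - ((T ^ n) x - w ^ n • x) = -((T ^ n) x - R x) := by
      change R x - w ^ n • x - ((T ^ n) x - w ^ n • x) = -((T ^ n) x - R x)
      abel
    rw [e]
    exact F.neg_mem (hTR x)

end Discrete

-- Norm estimates and completeness of the Lipschitz space.

universe u

variable {V : Type u} {G : SimpleGraph V} {ϑ : ℝ}

/-- Paths with different first edges are at distance `1`, so across districts boundedness already is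
a Lipschitz condition. -/
theorem lipSubmodule_mem_of_districts (hϑ : 0 < ϑ) {φ : Ray G → ℂ} {B C : ℝ}
    (hB : ∀ p, ‖φ p‖ ≤ B) (hC : IsLipConst ϑ SameDistrict φ C) : φ ∈ lipSubmodule G ϑ := by
  refine ⟨⟨B, hB⟩, C + 2 * |B|, by linarith [hC.1, abs_nonneg B], fun p q _ => ?_⟩
  by_cases hpq : p.1 0 = q.1 0
  · refine (hC.2 p q hpq).trans (mul_le_mul_of_nonneg_right ?_ (rayDist_nonneg hϑ p q))
    linarith [abs_nonneg B]
  · rw [rayDist_of_ne p q hpq, mul_one]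
    linarith [norm_sub_le (φ p) (φ q), hB p, hB q, hC.1, le_abs_self B]

theorem LipSpace.isLipConst_districtLip (hϑ : 0 < ϑ) (φ : LipSpace G ϑ) :
    IsLipConst ϑ SameDistrict φ.1 (districtLip ϑ φ.1) := by
  refine ⟨districtLip_nonneg _, fun p q hpq => le_of_forall_pos_le_add fun ε hε => ?_⟩
  have hd := rayDist_nonneg hϑ p q
  have hpos : 0 < rayDist ϑ p q + 1 := by linarith
  obtain ⟨C, hC, hlt⟩ := φ.exists_isLipConst (div_pos hε hpos)
  have h1 : ε / (rayDist ϑ p q + 1) * rayDist ϑ p q ≤ ε := by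
    rw [div_mul_eq_mul_div, div_le_iff₀ hpos]
    nlinarith
  calc ‖φ.1 p - φ.1 q‖ ≤ C * rayDist ϑ p q := hC.2 p q hpq
    _ ≤ (districtLip ϑ φ.1 + ε / (rayDist ϑ p q + 1)) * rayDist ϑ p q :=
        mul_le_mul_of_nonneg_right hlt.le hd
    _ ≤ districtLip ϑ φ.1 * rayDist ϑ p q + ε := by rw [add_mul]; linarith

theorem LipSpace.districtLip_le_norm (φ : LipSpace G ϑ) : districtLip ϑ φ.1 ≤ ‖φ‖ := by
  rw [LipSpace.norm_def]
  linarith [supNorm_nonneg φ.1]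

theorem LipSpace.norm_apply_le (φ : LipSpace G ϑ) (p : Ray G) : ‖φ.1 p‖ ≤ ‖φ‖ := by
  rw [LipSpace.norm_def]
  linarith [φ.le_supNorm p, districtLip_nonneg (ϑ := ϑ) φ.1]

theorem LipSpace.norm_sub_apply_le (hϑ : 0 < ϑ) (φ : LipSpace G ϑ) {p q : Ray G}
    (h : p.1 0 = q.1 0) : ‖φ.1 p - φ.1 q‖ ≤ ‖φ‖ * rayDist ϑ p q :=
  ((φ.isLipConst_districtLip hϑ).2 p q h).trans
    (mul_le_mul_of_nonneg_right φ.districtLip_le_norm (rayDist_nonneg hϑ p q))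

theorem LipSpace.norm_le_of {φ : LipSpace G ϑ} {B C : ℝ} (hB : 0 ≤ B)
    (h : ∀ p, ‖φ.1 p‖ ≤ B) (hC : IsLipConst ϑ SameDistrict φ.1 C) : ‖φ‖ ≤ C + B := by
  rw [LipSpace.norm_def]
  exact add_le_add (districtLip_le hC) (supNorm_le hB h)

/-- Sup bounds and Lipschitz bounds both pass to pointwise limits, first for the sequence itself and
then for its differences. -/
theorem completeSpace_lipSpace (hϑ : 0 < ϑ) : CompleteSpace (LipSpace G ϑ) := by
  refine Metric.complete_of_cauchySeq_tendsto fun u hu => ?_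
  have hpt : ∀ p, ∃ c : ℂ, Tendsto (fun n => (u n).1 p) atTop (𝓝 c) := by
    intro p
    refine cauchySeq_tendsto_of_complete (Metric.cauchySeq_iff.mpr fun ε hε => ?_)
    obtain ⟨N, hN⟩ := Metric.cauchySeq_iff.mp hu ε hε
    refine ⟨N, fun m hm n hn => lt_of_le_of_lt ?_ (hN m hm n hn)⟩
    rw [dist_eq_norm, dist_eq_norm]
    exact LipSpace.norm_apply_le (u m - u n) p
  choose ψ hψ using hpt
  obtain ⟨B, hB⟩ := isBounded_iff_forall_norm_le.mp hu.isBounded_range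
  have hB' : ∀ n, ‖u n‖ ≤ B := fun n => hB _ ⟨n, rfl⟩
  have hB0 : 0 ≤ B := (norm_nonneg _).trans (hB' 0)
  have hmem : ψ ∈ lipSubmodule G ϑ := by
    refine lipSubmodule_mem_of_districts hϑ (B := B) (C := B) (fun p => ?_) ⟨hB0, fun p q hpq => ?_⟩
    · exact le_of_tendsto (hψ p).norm (Eventually.of_forall fun n =>
        ((u n).norm_apply_le p).trans (hB' n))
    · exact le_of_tendsto ((hψ p).sub (hψ q)).norm (Eventually.of_forall fun n =>
        ((u n).norm_sub_apply_le hϑ hpq).trans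
          (mul_le_mul_of_nonneg_right (hB' n) (rayDist_nonneg hϑ p q)))
  obtain ⟨Ψ, rfl⟩ : ∃ Ψ : LipSpace G ϑ, Ψ.1 = ψ := ⟨⟨ψ, hmem⟩, rfl⟩
  refine ⟨Ψ, Metric.tendsto_atTop.mpr fun ε hε => ?_⟩
  obtain ⟨N, hN⟩ := Metric.cauchySeq_iff.mp hu (ε / 3) (by positivity)
  refine ⟨N, fun n hn => ?_⟩
  have hd : ∀ m, N ≤ m → ‖u n - u m‖ ≤ ε / 3 := fun m hm => by
    rw [← dist_eq_norm]; exact (hN n hn m hm).le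
  rw [dist_eq_norm]
  refine (LipSpace.norm_le_of (B := ε / 3) (C := ε / 3) (by positivity) (fun p => ?_)
    ⟨by positivity, fun p q hpq => ?_⟩).trans_lt (by linarith)
  · refine le_of_tendsto (tendsto_const_nhds.sub (hψ p)).norm
      (eventually_atTop.mpr ⟨N, fun m hm => ?_⟩)
    exact (LipSpace.norm_apply_le (u n - u m) p).trans (hd m hm)
  · refine le_of_tendsto ((tendsto_const_nhds.sub (hψ p)).sub
      (tendsto_const_nhds.sub (hψ q))).norm (eventually_atTop.mpr ⟨N, fun m hm => ?_⟩)
    exact (LipSpace.norm_sub_apply_le hϑ (u n - u m) hpq).trans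
      (mul_le_mul_of_nonneg_right (hd m hm) (rayDist_nonneg hϑ p q))

/-! ### Cylinders -/

/-- The paths `p` and `q` have the same edges up to index `n`. -/
def AgreeUpTo (n : ℕ) (p q : Ray G) : Prop := ∀ i ≤ n, p.1 i = q.1 i

/-- Agreement up to index `n` as an equivalence relation. -/
def agreeSetoid (G : SimpleGraph V) (n : ℕ) : Setoid (Ray G) where
  r := AgreeUpTo n
  iseqv := ⟨fun _ _ _ => rfl, fun h i hi => (h i hi).symm,
    fun h k i hi => (h i hi).trans (k i hi)⟩

/-- A chosen path in the cylinder of `p` of depth `n`. -/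
noncomputable def cylinderRep (n : ℕ) (p : Ray G) : Ray G :=
  (Quotient.mk (agreeSetoid G n) p).out

theorem agreeUpTo_cylinderRep (n : ℕ) (p : Ray G) : AgreeUpTo n (cylinderRep n p) p :=
  Quotient.exact (s := agreeSetoid G n) (Quotient.out_eq _)

theorem AgreeUpTo.cylinderRep_eq {n : ℕ} {p q : Ray G} (h : AgreeUpTo n p q) :
    cylinderRep n p = cylinderRep n q :=
  congrArg Quotient.out (Quotient.sound (s := agreeSetoid G n) h)

theorem AgreeUpTo.rayDist_le (hϑ0 : 0 < ϑ) (hϑ1 : ϑ < 1) {n : ℕ} {p q : Ray G}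
    (h : AgreeUpTo n p q) : rayDist ϑ p q ≤ ϑ ^ n := by
  unfold rayDist
  split_ifs with hpq
  · positivity
  · refine pow_le_pow_of_le_one hϑ0.le hϑ1.le (le_csInf ?_ fun i hi => ?_)
    · by_contra hS
      exact hpq (Subtype.ext (funext fun i => by
        by_contra hi
        exact hS ⟨i, hi⟩))
    · by_contra hlt
      exact hi (h i (by omega))

theorem pow_le_rayDist (hϑ0 : 0 < ϑ) (hϑ1 : ϑ < 1) {n : ℕ} {p q : Ray G}
    (h : ¬ AgreeUpTo n p q) : ϑ ^ n ≤ rayDist ϑ p q := by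
  obtain ⟨i, hi, hne⟩ : ∃ i ≤ n, p.1 i ≠ q.1 i := by
    unfold AgreeUpTo at h
    push Not at h
    exact h
  have hpq : p ≠ q := fun e => hne (by rw [e])
  rw [rayDist, if_neg hpq]
  exact pow_le_pow_of_le_one hϑ0.le hϑ1.le ((Nat.sInf_le hne).trans hi)

theorem comp_cylinderRep_mem (hϑ0 : 0 < ϑ) (hϑ1 : ϑ < 1) (n : ℕ) (φ : LipSpace G ϑ) :
    (fun p => φ.1 (cylinderRep n p)) ∈ lipSubmodule G ϑ := by
  have hpos : 0 < ϑ ^ n := pow_pos hϑ0 n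
  -- The function is constant on cylinders; paths in different cylinders are at least `ϑ ^ n` apart
  -- and the values differ by at most `2 * ‖φ‖`.
  refine lipSubmodule_mem_of_districts hϑ0 (fun p => φ.norm_apply_le _)
    (C := 2 * ‖φ‖ / ϑ ^ n) ⟨by positivity, fun p q _ => ?_⟩
  change ‖φ.1 (cylinderRep n p) - φ.1 (cylinderRep n q)‖ ≤ _
  by_cases h : AgreeUpTo n p q
  · rw [h.cylinderRep_eq, sub_self, norm_zero]
    exact mul_nonneg (by positivity) (rayDist_nonneg hϑ0 p q)
  · calc _ ≤ ‖φ‖ + ‖φ‖ := (norm_sub_le _ _).trans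
          (add_le_add (φ.norm_apply_le _) (φ.norm_apply_le _))
      _ = 2 * ‖φ‖ / ϑ ^ n * ϑ ^ n := by rw [div_mul_cancel₀ _ hpos.ne', two_mul]
      _ ≤ _ := mul_le_mul_of_nonneg_left (pow_le_rayDist hϑ0 hϑ1 h) (by positivity)

/-! ### Iterates of the transfer operator. -/

variable [Finite V]

/-- The number of non-backtracking extensions of the edge `f` to the left by `n` edges. -/
noncomputable def predCount : ℕ → G.Dart → ℝ
  | 0, _ => 1
  | n + 1, f => ∑ e : TurnInto f, predCount n e.1

theorem transfer_pow_succ_apply (φ : Ray G → ℂ) (n : ℕ) (p : Ray G) :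
    (transfer G ^ (n + 1)) φ p = ∑ e : TurnInto (p.1 0), (transfer G ^ n) φ (p.cons e) := by
  rw [pow_succ']
  rfl

theorem transfer_pow_one_apply (n : ℕ) (p : Ray G) :
    (transfer G ^ n) (fun _ => 1) p = (predCount n (p.1 0) : ℂ) := by
  induction n generalizing p with
  | zero => simp [predCount]
  | succ n ih =>
    rw [transfer_pow_succ_apply, predCount, Complex.ofReal_sum]
    exact Finset.sum_congr rfl fun e _ => ih _

theorem norm_transfer_pow_le {φ : Ray G → ℂ} {B : ℝ} (h : ∀ p, ‖φ p‖ ≤ B) (n : ℕ)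
    (p : Ray G) : ‖(transfer G ^ n) φ p‖ ≤ B * predCount n (p.1 0) := by
  induction n generalizing p with
  | zero => simpa [predCount] using h p
  | succ n ih =>
    rw [transfer_pow_succ_apply, predCount, Finset.mul_sum]
    exact (norm_sum_le _ _).trans (Finset.sum_le_sum fun e _ => ih _)

theorem predCount_nonneg (n : ℕ) (f : G.Dart) : 0 ≤ predCount n f := by
  induction n generalizing f with
  | zero => exact zero_le_one
  | succ n ih => exact Finset.sum_nonneg fun e _ => ih _

/-- Iterates of the transfer operator contract the Lipschitz constants of functions that are
Lipschitz on the cylinders of depth `n`. -/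
theorem norm_transfer_pow_sub_le (hϑ : 0 < ϑ) {φ : Ray G → ℂ} {C : ℝ} (hC : 0 ≤ C) {n : ℕ}
    (h : ∀ p q, AgreeUpTo n p q → ‖φ p - φ q‖ ≤ C * rayDist ϑ p q) (k : ℕ) (p q : Ray G)
    (hpq : AgreeUpTo (n - k) p q) :
    ‖(transfer G ^ k) φ p - (transfer G ^ k) φ q‖ ≤
      C * ϑ ^ k * predCount k (p.1 0) * rayDist ϑ p q := by
  induction k generalizing p q with
  | zero => simpa [predCount] using h p q hpq
  | succ k ih =>
    obtain ⟨q, hq⟩ := q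
    have hd := rayDist_nonneg hϑ p ⟨q, hq⟩
    have e2 : (transfer G ^ (k + 1)) φ ⟨q, hq⟩ = ∑ e : TurnInto (p.1 0),
        (transfer G ^ k) φ (Ray.cons ⟨q, hq⟩ ⟨e.1, hpq 0 (Nat.zero_le _) ▸ e.2⟩) := by
      -- The two sums run over types indexed by the first edges of the two paths; generalizing the
      -- edge allows both to be taken over the same type and compared term by term.
      have key : ∀ (f : G.Dart) (hf : f = q 0), (transfer G ^ (k + 1)) φ ⟨q, hq⟩ =
          ∑ e : TurnInto f, (transfer G ^ k) φ (Ray.cons ⟨q, hq⟩ ⟨e.1, hf ▸ e.2⟩) := by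
        intro f hf
        subst hf
        exact transfer_pow_succ_apply _ _ _
      exact key _ (hpq 0 (Nat.zero_le _))
    rw [transfer_pow_succ_apply, e2, ← Finset.sum_sub_distrib, predCount, Finset.mul_sum,
      Finset.sum_mul]
    refine (norm_sum_le _ _).trans (Finset.sum_le_sum fun e _ => ?_)
    refine (ih _ _ ?_).trans ?_
    -- A common prepended edge lengthens the agreement by one. The truncated `n - k` still works for
    -- `k ≥ n`, where it only requires a common first edge.
    · intro i hi
      cases i with
      | zero => rfl
      | succ i => exact hpq i (by omega)
    · have h1 : rayDist ϑ (p.cons e) (Ray.cons ⟨q, hq⟩ ⟨e.1, hpq 0 (Nat.zero_le _) ▸ e.2⟩) ≤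
          ϑ * rayDist ϑ p ⟨q, hq⟩ :=
        rayDist_cons_le hϑ p ⟨q, hq⟩ _ _ rfl (fun _ => rfl) (fun _ => rfl)
      have h2 : 0 ≤ C * ϑ ^ k * predCount k e.1 :=
        mul_nonneg (mul_nonneg hC (by positivity)) (predCount_nonneg _ _)
      calc _ ≤ C * ϑ ^ k * predCount k e.1 * (ϑ * rayDist ϑ p ⟨q, hq⟩) :=
            mul_le_mul_of_nonneg_left h1 h2
        _ = _ := by ring

/-! ### The remainder of the transfer operator -/

theorem lipTransfer_pow_coe (hϑ : 0 < ϑ) (n : ℕ) (φ : LipSpace G ϑ) :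
    ((lipTransfer G ϑ hϑ ^ n) φ).1 = (transfer G ^ n) φ.1 := by
  induction n with
  | zero => rfl
  | succ n ih =>
    rw [pow_succ', pow_succ', Module.End.mul_apply, ← ih]
    rfl

/-- The constant function `1`. -/
def oneLip (G : SimpleGraph V) (ϑ : ℝ) : LipSpace G ϑ :=
  ⟨fun _ => 1, ⟨1, fun _ => by simp⟩, 0, le_rfl, fun p q _ => by simp⟩

/-- The counts are the values of `T ^ n 1`, and the constant `1` has norm at most `1`. This turns
the combinatorial weights in the estimates for iterates into `‖T ^ n‖`. -/
theorem predCount_le_norm (hϑ : 0 < ϑ) (n : ℕ) (p : Ray G) :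
    predCount n (p.1 0) ≤ ‖lipTransfer G ϑ hϑ ^ n‖ := by
  have h1 : ‖oneLip G ϑ‖ ≤ 1 := by
    refine (LipSpace.norm_le_of (B := 1) (C := 0) zero_le_one (fun p => ?_)
      ⟨le_rfl, fun p q _ => ?_⟩).trans_eq (zero_add 1)
    · simp [oneLip]
    · simp [oneLip]
  have h2 := LipSpace.norm_apply_le ((lipTransfer G ϑ hϑ ^ n) (oneLip G ϑ)) p
  rw [lipTransfer_pow_coe] at h2
  have h3 : (transfer G ^ n) (oneLip G ϑ).1 p = (predCount n (p.1 0) : ℂ) :=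
    transfer_pow_one_apply n p
  rw [h3, Complex.norm_real, Real.norm_of_nonneg (predCount_nonneg _ _)] at h2
  calc _ ≤ ‖(lipTransfer G ϑ hϑ ^ n) (oneLip G ϑ)‖ := h2
    _ ≤ ‖lipTransfer G ϑ hϑ ^ n‖ * ‖oneLip G ϑ‖ := ContinuousLinearMap.le_opNorm _ _
    _ ≤ _ := mul_le_of_le_one_right (norm_nonneg _) h1

/-- Functions depending only on the first edge. -/
def firstEdgeSubmodule (G : SimpleGraph V) (ϑ : ℝ) : Submodule ℂ (LipSpace G ϑ) where
  carrier := {φ | ∀ p q : Ray G, p.1 0 = q.1 0 → φ.1 p = φ.1 q}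
  add_mem' := fun hφ hψ p q h => congrArg₂ (· + ·) (hφ p q h) (hψ p q h)
  zero_mem' := fun _ _ _ => rfl
  smul_mem' := fun c _ hφ p q h => congrArg (c * ·) (hφ p q h)

open Classical in
/-- The value of a function on some path with a given first edge. -/
noncomputable def firstEdgeValue (G : SimpleGraph V) (ϑ : ℝ) : LipSpace G ϑ →ₗ[ℂ] (G.Dart → ℂ) where
  toFun φ f := if h : ∃ p : Ray G, p.1 0 = f then φ.1 h.choose else 0
  map_add' φ ψ := by
    funext f
    by_cases h : ∃ p : Ray G, p.1 0 = f
    · simp only [dif_pos h, Pi.add_apply]; rfl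
    · simp [dif_neg h]
  map_smul' c φ := by
    funext f
    by_cases h : ∃ p : Ray G, p.1 0 = f
    · simp only [dif_pos h, Pi.smul_apply, RingHom.id_apply]; rfl
    · simp [dif_neg h]

/-- Such a function is determined by one value per edge. The default `0` of `firstEdgeValue` does no
harm: injectivity is tested only at first edges of actual paths. -/
instance finiteDimensional_firstEdgeSubmodule :
    FiniteDimensional ℂ (firstEdgeSubmodule G ϑ) := by
  have := Fintype.ofFinite G.Dart
  refine FiniteDimensional.of_injective
    ((firstEdgeValue G ϑ).domRestrict (firstEdgeSubmodule G ϑ)) ?_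
  rintro ⟨φ, hφ⟩ ⟨ψ, hψ⟩ h
  refine Subtype.ext (Subtype.ext (funext fun p => ?_))
  have hex : ∃ q : Ray G, q.1 0 = p.1 0 := ⟨p, rfl⟩
  have h1 : firstEdgeValue G ϑ φ (p.1 0) = firstEdgeValue G ϑ ψ (p.1 0) := congrFun h (p.1 0)
  simp only [firstEdgeValue, LinearMap.coe_mk, AddHom.coe_mk, dif_pos hex] at h1
  exact (hφ _ _ hex.choose_spec.symm).trans (h1.trans (hψ _ _ hex.choose_spec))

/-- Replace a function by its values at the chosen paths of the cylinders of depth `n`. -/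
noncomputable def cylinderApprox (hϑ0 : 0 < ϑ) (hϑ1 : ϑ < 1) (n : ℕ) :
    LipSpace G ϑ →ₗ[ℂ] LipSpace G ϑ where
  toFun φ := ⟨fun p => φ.1 (cylinderRep n p), comp_cylinderRep_mem hϑ0 hϑ1 n φ⟩
  map_add' _ _ := rfl
  map_smul' _ _ := rfl

/-- The `2` counts the two halves of the norm. For the sup-norm, `ϑ ^ n` is the diameter bound of a
cylinder; for the Lipschitz part, it comes from prepending `n` edges. -/
theorem norm_lipTransfer_pow_sub_cylinderApprox_le (hϑ0 : 0 < ϑ) (hϑ1 : ϑ < 1) (n : ℕ)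
    (φ : LipSpace G ϑ) :
    ‖(lipTransfer G ϑ hϑ0 ^ n) (φ - cylinderApprox hϑ0 hϑ1 n φ)‖ ≤
      2 * ϑ ^ n * ‖lipTransfer G ϑ hϑ0 ^ n‖ * ‖φ‖ := by
  set M := ‖lipTransfer G ϑ hϑ0 ^ n‖
  have hM : 0 ≤ M := norm_nonneg _
  have happ : ∀ p, (φ - cylinderApprox hϑ0 hϑ1 n φ).1 p = φ.1 p - φ.1 (cylinderRep n p) :=
    fun p => rfl
  have hsup : ∀ p, ‖(φ - cylinderApprox hϑ0 hϑ1 n φ).1 p‖ ≤ ‖φ‖ * ϑ ^ n := by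
    intro p
    have h := fun i hi => (agreeUpTo_cylinderRep n p i hi).symm
    rw [happ]
    exact (φ.norm_sub_apply_le hϑ0 (h 0 (Nat.zero_le _))).trans
      (mul_le_mul_of_nonneg_left (AgreeUpTo.rayDist_le hϑ0 hϑ1 h) (norm_nonneg _))
  have hlip : ∀ p q, AgreeUpTo n p q → ‖(φ - cylinderApprox hϑ0 hϑ1 n φ).1 p -
      (φ - cylinderApprox hϑ0 hϑ1 n φ).1 q‖ ≤ ‖φ‖ * rayDist ϑ p q := by
    intro p q h
    -- Inside one cylinder the approximation is constant and cancels, so the Lipschitz bound is that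
    -- of `φ`, with no loss.
    rw [happ, happ, h.cylinderRep_eq, sub_sub_sub_cancel_right]
    exact φ.norm_sub_apply_le hϑ0 (h 0 (Nat.zero_le _))
  refine (LipSpace.norm_le_of (B := ‖φ‖ * ϑ ^ n * M) (C := ‖φ‖ * ϑ ^ n * M) (by positivity)
    (fun p => ?_) ⟨by positivity, fun p q hpq => ?_⟩).trans_eq (by ring)
  · rw [lipTransfer_pow_coe]
    exact (norm_transfer_pow_le hsup n p).trans
      (mul_le_mul_of_nonneg_left (predCount_le_norm hϑ0 n p) (by positivity))
  · rw [lipTransfer_pow_coe]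
    refine (norm_transfer_pow_sub_le hϑ0 (norm_nonneg φ) hlip n p q ?_).trans ?_
    · intro i hi
      obtain rfl : i = 0 := by omega
      exact hpq
    · exact mul_le_mul_of_nonneg_right (mul_le_mul_of_nonneg_left (predCount_le_norm hϑ0 n p)
        (by positivity)) (rayDist_nonneg hϑ0 p q)

/-- This is the contraction estimate with Lipschitz constant `0`. -/
theorem lipTransfer_pow_mem_firstEdge (hϑ : 0 < ϑ) {φ : LipSpace G ϑ} {n k : ℕ} (hnk : n ≤ k)
    (h : ∀ p q, AgreeUpTo n p q → φ.1 p = φ.1 q) :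
    (lipTransfer G ϑ hϑ ^ k) φ ∈ firstEdgeSubmodule G ϑ := by
  intro p q hpq
  rw [lipTransfer_pow_coe]
  have key := norm_transfer_pow_sub_le hϑ le_rfl (C := 0) (φ := φ.1) (n := n)
    (fun p q hpq => by rw [h p q hpq]; simp) k p q (fun i hi => by
      obtain rfl : i = 0 := by omega
      exact hpq)
  rw [zero_mul, zero_mul, zero_mul] at key
  exact sub_eq_zero.mp (norm_le_zero_iff.mp key)

theorem lipTransfer_mem_firstEdge (hϑ : 0 < ϑ) {φ : LipSpace G ϑ}
    (h : φ ∈ firstEdgeSubmodule G ϑ) : lipTransfer G ϑ hϑ φ ∈ firstEdgeSubmodule G ϑ := by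
  have := lipTransfer_pow_mem_firstEdge hϑ (n := 0) (k := 1) zero_le_one
    fun p q hpq => h p q (hpq 0 le_rfl)
  rwa [pow_one] at this

/-- The remainder `T ^ n (1 - P)`, with `P` the approximation on cylinders of depth `n`. -/
noncomputable def transferRemainder (G : SimpleGraph V) (hϑ0 : 0 < ϑ) (hϑ1 : ϑ < 1) (n : ℕ) :
    LipSpace G ϑ →L[ℂ] LipSpace G ϑ :=
  LinearMap.mkContinuous
    { toFun := fun φ => (lipTransfer G ϑ hϑ0 ^ n) (φ - cylinderApprox hϑ0 hϑ1 n φ)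
      map_add' := fun φ ψ => by rw [map_add, add_sub_add_comm, map_add]
      map_smul' := fun c φ => by rw [map_smul, ← smul_sub, map_smul, RingHom.id_apply] }
    (2 * ϑ ^ n * ‖lipTransfer G ϑ hϑ0 ^ n‖)
    (norm_lipTransfer_pow_sub_cylinderApprox_le hϑ0 hϑ1 n)

theorem transferRemainder_apply (hϑ0 : 0 < ϑ) (hϑ1 : ϑ < 1) (n : ℕ) (φ : LipSpace G ϑ) :
    transferRemainder G hϑ0 hϑ1 n φ =
      (lipTransfer G ϑ hϑ0 ^ n) (φ - cylinderApprox hϑ0 hϑ1 n φ) := rfl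

theorem norm_transferRemainder_le (hϑ0 : 0 < ϑ) (hϑ1 : ϑ < 1) (n : ℕ) :
    ‖transferRemainder G hϑ0 hϑ1 n‖ ≤ 2 * ϑ ^ n * ‖lipTransfer G ϑ hϑ0 ^ n‖ :=
  LinearMap.mkContinuous_norm_le _ (by positivity) _

theorem transferRemainder_eq_zero (hϑ0 : 0 < ϑ) (hϑ1 : ϑ < 1) (n : ℕ) {φ : LipSpace G ϑ}
    (h : φ ∈ firstEdgeSubmodule G ϑ) : transferRemainder G hϑ0 hϑ1 n φ = 0 := by
  have : cylinderApprox hϑ0 hϑ1 n φ = φ :=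
    Subtype.ext (funext fun p => h _ _ (agreeUpTo_cylinderRep n p 0 (Nat.zero_le _)))
  rw [transferRemainder_apply, this, sub_self, map_zero]

theorem lipTransfer_pow_sub_transferRemainder_mem (hϑ0 : 0 < ϑ) (hϑ1 : ϑ < 1) (n : ℕ)
    (φ : LipSpace G ϑ) :
    (lipTransfer G ϑ hϑ0 ^ n) φ - transferRemainder G hϑ0 hϑ1 n φ ∈ firstEdgeSubmodule G ϑ := by
  rw [transferRemainder_apply, map_sub, sub_sub_cancel]
  exact lipTransfer_pow_mem_firstEdge hϑ0 le_rfl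
    fun p q hpq => congrArg φ.1 hpq.cylinderRep_eq

/-! ### Gelfand's formula and conclusion. -/

/-- Gelfand's formula, as a strict bound for a scaled sequence of powers. -/
theorem exists_mul_norm_pow_lt {A : Type*} [NormedRing A] [NormedAlgebra ℂ A] [CompleteSpace A]
    (a : A) (c : ℝ) {r s : ℝ} (hr : 0 < r)
    (h : ENNReal.ofReal r * spectralRadius ℂ a < ENNReal.ofReal s) :
    ∃ n : ℕ, c * r ^ n * ‖a ^ n‖ < s ^ n := by
  have hs : 0 < s := ENNReal.ofReal_pos.mp (zero_le.trans_lt h)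
  have h1 : spectralRadius ℂ a < ENNReal.ofReal (s / r) := by
    rw [ENNReal.ofReal_div_of_pos hr, ENNReal.lt_div_iff_mul_lt
      (Or.inl (ENNReal.ofReal_pos.mpr hr).ne') (Or.inl ENNReal.ofReal_ne_top), mul_comm]
    exact h
  -- Eventually `‖a ^ n‖ ≤ t ^ n`, and `r * t / s < 1` leaves a geometric factor that absorbs the
  -- constant `c`.
  obtain ⟨t, ht1, ht2⟩ := exists_between h1
  have htop : t ≠ ⊤ := ne_top_of_lt ht2
  have ht2' : t.toReal < s / r := by
    rw [← ENNReal.ofReal_toReal htop] at ht2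
    exact (ENNReal.ofReal_lt_ofReal_iff (by positivity)).mp ht2
  have ht0 : 0 ≤ t.toReal := ENNReal.toReal_nonneg
  have hq : r * t.toReal / s < 1 := by
    rw [div_lt_one hs, mul_comm]
    exact (lt_div_iff₀ hr).mp ht2'
  have hlim : Tendsto (fun n : ℕ => |c| * (r * t.toReal / s) ^ n) atTop (𝓝 (|c| * 0)) :=
    (tendsto_pow_atTop_nhds_zero_of_lt_one (by positivity) hq).const_mul _
  rw [mul_zero] at hlim
  obtain ⟨n, hn1, hn2, hn3⟩ := ((eventually_ge_atTop 1).and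
    (((spectrum.pow_norm_pow_one_div_tendsto_nhds_spectralRadius a).eventually_lt_const ht1).and
      (hlim.eventually_lt_const one_pos))).exists
  refine ⟨n, ?_⟩
  have hn : (n : ℝ) ≠ 0 := by positivity
  have h2 : ‖a ^ n‖ ≤ t.toReal ^ n := by
    have h3 : ‖a ^ n‖ ^ (1 / n : ℝ) ≤ t.toReal :=
      (ENNReal.ofReal_le_iff_le_toReal htop).mp hn2.le
    calc ‖a ^ n‖ = (‖a ^ n‖ ^ (1 / n : ℝ)) ^ n := by
          rw [← Real.rpow_natCast, ← Real.rpow_mul (norm_nonneg _), one_div_mul_cancel hn,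
            Real.rpow_one]
      _ ≤ _ := pow_le_pow_left₀ (by positivity) h3 n
  have hsn : 0 < s ^ n := pow_pos hs n
  calc c * r ^ n * ‖a ^ n‖ ≤ |c| * r ^ n * t.toReal ^ n := by
        gcongr
        exact le_abs_self c
    _ = |c| * (r * t.toReal / s) ^ n * s ^ n := by
        rw [div_pow, mul_pow]; field_simp
    _ < 1 * s ^ n := mul_lt_mul_of_pos_right hn3 hsn
    _ = s ^ n := one_mul _

theorem isDiscreteEigenvalue_lipTransfer (hϑ0 : 0 < ϑ) (hϑ1 : ϑ < 1) {z : ℂ}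
    (hz : z ∈ spectrum ℂ (lipTransfer G ϑ hϑ0))
    (hlt : ENNReal.ofReal ϑ * spectralRadius ℂ (lipTransfer G ϑ hϑ0) < ENNReal.ofReal ‖z‖) :
    IsDiscreteEigenvalue (lipTransfer G ϑ hϑ0) z := by
  have := completeSpace_lipSpace (G := G) hϑ0
  have hmod : ∀ w : ℂ,
      ENNReal.ofReal ϑ * spectralRadius ℂ (lipTransfer G ϑ hϑ0) < ENNReal.ofReal ‖w‖ →
      (∀ x, lipTransfer G ϑ hϑ0 x - w • x ∈ firstEdgeSubmodule G ϑ →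
        x ∈ firstEdgeSubmodule G ϑ) ∧
      ∀ y, ∃ x, y - (lipTransfer G ϑ hϑ0 x - w • x) ∈ firstEdgeSubmodule G ϑ := by
    intro w hw
    -- The exponent depends on `w`, but the subspace does not, so one `F` serves the whole region.
    obtain ⟨n, hn⟩ := exists_mul_norm_pow_lt (lipTransfer G ϑ hϑ0) 2 hϑ0 hw
    exact bijective_mod_of_pow_approx _ (transferRemainder G hϑ0 hϑ1 n) _
      (fun x hx => lipTransfer_mem_firstEdge hϑ0 hx)
      (fun x hx => transferRemainder_eq_zero hϑ0 hϑ1 n hx) n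
      (lipTransfer_pow_sub_transferRemainder_mem hϑ0 hϑ1 n)
      ((norm_transferRemainder_le hϑ0 hϑ1 n).trans_lt hn)
  exact isDiscreteEigenvalue_of_bijective_mod _ (firstEdgeSubmodule G ϑ)
    (fun x hx => lipTransfer_mem_firstEdge hϑ0 hx)
    (U := {w | ENNReal.ofReal ϑ * spectralRadius ℂ (lipTransfer G ϑ hϑ0) < ENNReal.ofReal ‖w‖})
    (isOpen_lt continuous_const (ENNReal.continuous_ofReal.comp continuous_norm))
    (fun w hw => (hmod w hw).1) (fun w hw => (hmod w hw).2) hlt hz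

end GraphTransfer

theorem mainTheorem9 {V : Type*} [Finite V] (G : SimpleGraph V) [G.LocallyFinite]
    (hconn : G.Connected) (hdeg : ∀ v, 2 ≤ G.degree v)
    (ϑ : ℝ) (hϑ0 : 0 < ϑ) (hϑ1 : ϑ < 1) :
    GraphTransfer.essentialSpectralRadius (GraphTransfer.lipTransfer G ϑ hϑ0) ≤
      ENNReal.ofReal ϑ * spectralRadius ℂ (GraphTransfer.lipTransfer G ϑ hϑ0) := by
  refine iSup₂_le fun z hz => ?_
  by_contra hlt
  rw [not_le, ← ENNReal.ofReal_coe_nnreal, coe_nnnorm] at hlt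
  exact hz.2 (GraphTransfer.isDiscreteEigenvalue_lipTransfer hϑ0 hϑ1 hz.1 hlt)
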